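/- Let $0<\beta<2$, $\eta>0$, $t>0$, and for $\alpha>0$ let $$N(x,t)=\frac{t^{\beta-1}}{\alpha|x|}\,H^{2,1}_{3,3}\!\left[\frac{|x|}{(\eta t^\beta)^{1/\alpha}}\,\middle|\,{(1,\frac1\alpha),(\beta,\frac\beta\alpha),(1,\frac12)\atop(1,1),(1,\frac1\alpha),(1,\frac12)}\right],\qquad x\neq0,$$ the closed-form solution of the fractional diffusion equation $d^\beta N/dt^\beta=\eta\,{}_{-\infty}D_x^\alpha N$. Here the H-function is the Mellin–Barnes integral $$H^{m,n}_{p,q}\!\left[z\,\middle|\,{(a_p,A_p)\atop(b_q,B_q)}\right]=\frac1{2\pi i}\int_{\gamma-i\infty}^{\gamma+i\infty}\frac{\prod_{j=1}^m\Gamma(b_j+B_j\xi)\prod_{j=1}^n\Gamma(1-a_j-A_j\xi)}{\prod_{j=m+1}^q\Gamma(1-b_j-B_j\xi)\prod_{j=n+1}^p\Gamma(a_j+A_j\xi)}\,z^{-\xi}\,d\xi$$ along any vertical line $\operatorname{Re}\xi=\gamma$ that has the poles of $\Gamma(b_j+B_j\xi)$, $j\le m$, on its left and the poles of $\Gamma(1-a_j-A_j\xi)$,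 $j\le n$, on its right. For $\delta\in\mathbb C$ put $\langle|x|^\delta\rangle=\int_{-\infty}^\infty|x|^\delta N(x,t)\,dx$. 1. Let $\operatorname{Re}\delta>-1$ and $\operatorname{Re}\delta+\alpha>0$, let $\operatorname{Re}\delta<\alpha$ unless $\alpha$ is an even integer, and let $\delta\ne k\alpha$ for $k=0,1,2,\dots$ Then $|x|^\delta N(x,t)$ is integrable over $\mathbb R$ and $$\langle|x|^\delta\rangle=\frac2\alpha\,\eta^{\delta/\alpha}\,t^{\beta\{\delta/\alpha+1-1/\beta\}}\,\frac{\Gamma(-\frac\delta\alpha)\,\Gamma(1+\delta)\,\Gamma(1+\frac\delta\alpha)}{\Gamma(-\frac\delta2)\,\Gamma(\beta+\frac{\beta\delta}\alpha)\,\Gamma(1+\frac\delta2)},$$ where $1/\Gamma$ is $0$ at the poles of $\Gamma$. 2. For every $\alpha>0$, $\displaystyle\lim_{\delta\to0}\langle|x|^\delta\rangle=\frac{t^{\beta-1}}{\Gamma(\beta)}$. 3. For $\alpha=2$ the function $x^2N(x,t)$ is integrable and the mean squared displacement is $$\langle x^2\rangle=\frac{2\eta\,t^{2\beta-1}}{\Gamma(2\beta)}.$$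 This is also the limit for $\alpha\to2$ followed by $\delta\to2$: for $-1<\operatorname{Re}\delta<2$ the moment $\langle|x|^\delta\rangle$ tends, as $\alpha\to2$, to its value at $\alpha=2$, and for $\alpha=2$ one has $\lim_{\delta\to2}\langle|x|^\delta\rangle=2\eta\,t^{2\beta-1}/\Gamma(2\beta)$. -/

import Mathlib

open Filter Topology MeasureTheory

noncomputable section

namespace FoxH

/-- The Mellin-Barnes kernel `Θ(ξ)` of the H-function `H^{m,n}_{p,q}` with upper parameters
`(a_j, A_j)` and lower parameters `(b_j, B_j)`. Indices start at `0`, so "the first `m`" reads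
`j < m`. Since `Complex.Gamma` is `0` at its poles and `x / 0 = 0`, the reciprocal gamma factors
take their usual value `0` at those points. -/
def kernel (m n : ℕ) {p q : ℕ} (a : Fin p → ℂ) (A : Fin p → ℝ) (b : Fin q → ℂ) (B : Fin q → ℝ)
    (ξ : ℂ) : ℂ :=
  ((∏ j ∈ Finset.univ.filter (fun j : Fin q => (j : ℕ) < m), Complex.Gamma (b j + B j * ξ)) *
    (∏ j ∈ Finset.univ.filter (fun j : Fin p => (j : ℕ) < n), Complex.Gamma (1 - a j - A j * ξ))) /
  ((∏ j ∈ Finset.univ.filter (fun j : Fin q => m ≤ (j : ℕ)), Complex.Gamma (1 - b j - B j * ξ)) *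
    (∏ j ∈ Finset.univ.filter (fun j : Fin p => n ≤ (j : ℕ)), Complex.Gamma (a j + A j * ξ)))

/-- The vertical line `Re ξ = γ` is an admissible contour: the poles `-(b_j + k) / B_j`
(`j < m`, `k ∈ ℕ`) lie to the left of it, the poles `(1 - a_i + k) / A_i` (`i < n`, `k ∈ ℕ`) to
the right. -/
def Separates (m n : ℕ) {p q : ℕ} (a : Fin p → ℂ) (A : Fin p → ℝ) (b : Fin q → ℂ) (B : Fin q → ℝ)
    (γ : ℝ) : Prop :=
  (∀ j : Fin q, (j : ℕ) < m → ∀ k : ℕ, (-(b j + k) / (B j : ℂ)).re < γ) ∧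
  (∀ i : Fin p, (i : ℕ) < n → ∀ k : ℕ, γ < ((1 - a i + k) / (A i : ℂ)).re)

/-- The H-function as the Mellin-Barnes integral
`(1 / (2 π i)) ∫_{γ - i∞}^{γ + i∞} Θ(ξ) z^{-ξ} dξ`, with `ξ = γ + i y`, `dξ = i dy`. -/
def H (m n : ℕ) {p q : ℕ} (a : Fin p → ℂ) (A : Fin p → ℝ) (b : Fin q → ℂ) (B : Fin q → ℝ)
    (γ : ℝ) (z : ℂ) : ℂ :=
  1 / (2 * Real.pi * Complex.I) *
    ∫ y : ℝ, kernel m n a A b B (γ + y * Complex.I) * z ^ (-(γ + y * Complex.I)) * Complex.I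

end FoxH

namespace FractionalDiffusion

/-- The upper parameters `(1, 1/α), (β, β/α), (1, 1/2)`: first entries. -/
def upper (β : ℝ) : Fin 3 → ℂ := ![1, β, 1]

/-- The upper parameters `(1, 1/α), (β, β/α), (1, 1/2)`: second entries. -/
def upperScale (α β : ℝ) : Fin 3 → ℝ := ![1 / α, β / α, 1 / 2]

/-- The lower parameters `(1, 1), (1, 1/α), (1, 1/2)`: first entries. -/
def lower : Fin 3 → ℂ := ![1, 1, 1]

/-- The lower parameters `(1, 1), (1, 1/α), (1, 1/2)`: second entries. -/
def lowerScale (α : ℝ) : Fin 3 → ℝ := ![1, 1 / α, 1 / 2]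

/-- The line `Re ξ = γ` is an admissible contour for the H-function occurring in `solution`. -/
def AdmissibleLine (α β γ : ℝ) : Prop :=
  FoxH.Separates 2 1 (upper β) (upperScale α β) lower (lowerScale α) γ

/-- The closed-form solution
`N(x,t) = t^{β-1} / (α |x|) · H^{2,1}_{3,3}[ |x| / (η t^β)^{1/α} ]`
of the fractional diffusion equation, the H-function being computed along `Re ξ = γ`. -/
def solution (α β η γ x t : ℝ) : ℂ :=
  ((t ^ (β - 1) / (α * |x|) : ℝ) : ℂ) *
    FoxH.H 2 1 (upper β) (upperScale α β) lower (lowerScale α) γ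
      ((|x| / (η * t ^ β) ^ (1 / α) : ℝ) : ℂ)

/-- The integrand `|x|^δ N(x,t)` of the moment of order `δ`. -/
def momentIntegrand (α β η γ t : ℝ) (δ : ℂ) (x : ℝ) : ℂ :=
  ((|x| : ℝ) : ℂ) ^ δ * solution α β η γ x t

/-- The fractional moment `⟨|x|^δ⟩(t) = ∫ |x|^δ N(x,t) dx` over the real line. -/
def moment (α β η γ t : ℝ) (δ : ℂ) : ℂ :=
  ∫ x : ℝ, momentIntegrand α β η γ t δ x

end FractionalDiffusion

end

/-! Up to the factor `t ^ (β - 1) / (α |x|)` and a rescaling of `|x|`, the solution is the inverse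
Mellin transform of its Mellin-Barnes kernel `Θ`. Integrating it against `|x| ^ δ` is therefore
twice a Mellin transform at `δ`, and Mellin inversion returns a scaled `Θ(δ)`. This needs a
holomorphic continuation of `Θ`, with decay in the imaginary direction, to a strip containing both
the contour and `Re δ` (`HasVerticalDecay.mellin_mellinInv`, `integrable_and_moment_eq`).

Decay: by reflection, `Θ(ξ) = Γ(1 + ξ) sin(πξ/2) / (sin(πξ/α) Γ(β + βξ/α))`. The vertical rates of
the factors add up to `-(π/α)(1 - β/2)`, which is negative exactly because `β < 2`
(`solutionKernel_bound`).

Continuation: the contour lies to the left of `0`, where the singularity is removable because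
`sin(πξ/2)` vanishes too; this reaches up to `Re ξ < α` (`stripKernel`). If `α = 2(n + 1)`, the
quotient of the sines is the Chebyshev value `U_n(cos(πξ/α))`, so nothing obstructs the continuation
on the right (`halfPlaneKernel`). The limits follow from continuity of these continuations in `δ`
and in `α`. -/

/-! ### Shifting vertical contours. -/

open Complex Set in
/-- The integral of a holomorphic function along a vertical line does not depend on the line,
provided the function decays like `1 / (1 + (Im s) ^ 2)`. -/
theorem integral_verticalLine_eq {F : ℂ → ℂ} {σ₁ σ₂ C : ℝ} (h : σ₁ ≤ σ₂)
    (hd : DifferentiableOn ℂ F (re ⁻¹' Icc σ₁ σ₂))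
    (hb : ∀ s : ℂ, s.re ∈ Icc σ₁ σ₂ → ‖F s‖ ≤ C * (1 + s.im ^ 2)⁻¹) :
    ∫ y : ℝ, F (σ₁ + y * I) = ∫ y : ℝ, F (σ₂ + y * I) := by
  have hint : ∀ σ ∈ Icc σ₁ σ₂, Integrable fun y : ℝ => F (σ + y * I) := by
    intro σ hσ
    refine (integrable_inv_one_add_sq.const_mul C).mono' ?_ (ae_of_all _ fun y => ?_)
    · refine Continuous.aestronglyMeasurable ?_
      exact hd.continuousOn.comp_continuous (by fun_prop) fun y => by simpa using hσ
    · simpa using hb (σ + y * I) (by simpa using hσ)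
  have hlim : ∀ σ ∈ Icc σ₁ σ₂, Tendsto (fun T : ℝ => ∫ y in (-T)..T, F (σ + y * I)) atTop
      (𝓝 (∫ y : ℝ, F (σ + y * I))) := fun σ hσ =>
    intervalIntegral_tendsto_integral (hint σ hσ) tendsto_neg_atTop_atBot tendsto_id
  have hinv : Tendsto (fun T : ℝ => C * (1 + T ^ 2)⁻¹ * |σ₂ - σ₁|) atTop (𝓝 0) := by
    have h1 : Tendsto (fun T : ℝ => 1 + T ^ 2) atTop atTop :=
      tendsto_atTop_add_const_left _ _ (tendsto_pow_atTop two_ne_zero)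
    simpa using (h1.inv_tendsto_atTop.const_mul C).mul_const |σ₂ - σ₁|
  have hhor : ∀ ε : ℝ, ε ^ 2 = 1 →
      Tendsto (fun T : ℝ => ∫ x in σ₁..σ₂, F (x + ((ε * T : ℝ) : ℂ) * I)) atTop (𝓝 0) := by
    intro ε hε
    refine squeeze_zero_norm (fun T => ?_) hinv
    refine intervalIntegral.norm_integral_le_of_norm_le_const fun x hx => ?_
    rw [uIoc_of_le h] at hx
    have := hb (x + ((ε * T : ℝ) : ℂ) * I) (by simpa using ⟨hx.1.le, hx.2⟩)
    simpa [mul_pow, hε] using this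
  have hrect : ∀ T : ℝ, (∫ y in (-T)..T, F (σ₂ + y * I)) - (∫ y in (-T)..T, F (σ₁ + y * I)) =
      I * ((∫ x in σ₁..σ₂, F (x + (((-1) * T : ℝ) : ℂ) * I)) -
        ∫ x in σ₁..σ₂, F (x + ((1 * T : ℝ) : ℂ) * I)) := by
    intro T
    have := integral_boundary_rect_eq_zero_of_differentiableOn F (⟨σ₁, -T⟩ : ℂ) ⟨σ₂, T⟩
      (hd.mono fun s hs => by
        have := hs.1
        simpa [uIcc_of_le h] using this)
    simp only [smul_eq_mul] at this
    rw [neg_one_mul, one_mul]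
    linear_combination (-I) * this + ((∫ y in (-T)..T, F (σ₂ + y * I)) -
      (∫ y in (-T)..T, F (σ₁ + y * I))) * I_mul_I
  have h0 := ((hhor (-1) (by norm_num)).sub (hhor 1 (by norm_num))).const_mul I
  have h1 := (hlim σ₂ ⟨h, le_rfl⟩).sub (hlim σ₁ ⟨le_rfl, h⟩)
  simp only [hrect] at h1
  have := tendsto_nhds_unique h1 h0
  rw [sub_zero, mul_zero, sub_eq_zero] at this
  exact this.symm

/-! ### Mellin inversion in a strip of decay. -/

/-- On every closed substrip of `a < Re s < b` the function is `O(1 / (1 + (Im s) ^ 2))`. -/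
def HasVerticalDecay (F : ℂ → ℂ) (a b : ℝ) : Prop :=
  ∀ σ₁ σ₂ : ℝ, a < σ₁ → σ₂ < b → ∃ C : ℝ, ∀ s : ℂ, σ₁ ≤ s.re → s.re ≤ σ₂ →
    ‖F s‖ ≤ C * (1 + s.im ^ 2)⁻¹

namespace HasVerticalDecay

open Complex Set

variable {F : ℂ → ℂ} {a b : ℝ}

theorem continuous_line (hd : DifferentiableOn ℂ F (re ⁻¹' Ioo a b)) {σ : ℝ}
    (ha : a < σ) (hb : σ < b) : Continuous fun y : ℝ => F (σ + y * I) :=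
  hd.continuousOn.comp_continuous (by fun_prop) fun y => by simpa using ⟨ha, hb⟩

theorem integrable_line (hF : HasVerticalDecay F a b)
    (hd : DifferentiableOn ℂ F (re ⁻¹' Ioo a b)) {σ : ℝ} (ha : a < σ) (hb : σ < b) :
    Integrable fun y : ℝ => F (σ + y * I) := by
  obtain ⟨C, hC⟩ := hF σ σ ha hb
  refine (integrable_inv_one_add_sq.const_mul C).mono'
    (continuous_line hd ha hb).aestronglyMeasurable (ae_of_all _ fun y => ?_)
  simpa using hC (σ + y * I) (by simp) (by simp)

theorem mellinInv_eq (hF : HasVerticalDecay F a b)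
    (hd : DifferentiableOn ℂ F (re ⁻¹' Ioo a b)) {σ₁ σ₂ : ℝ} (h₁ : a < σ₁) (h : σ₁ ≤ σ₂)
    (h₂ : σ₂ < b) {x : ℝ} (hx : 0 < x) : mellinInv σ₁ F x = mellinInv σ₂ F x := by
  obtain ⟨C, hC⟩ := hF σ₁ σ₂ h₁ h₂
  have hx' : (x : ℂ) ≠ 0 := ofReal_ne_zero.2 hx.ne'
  unfold mellinInv
  congr 1
  simp only [smul_eq_mul]
  -- On the strip `x ^ (-Re s)` is monotone in `Re s`, hence at most the sum of its two endpoint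
  -- values, whichever side of `1` contains `x`.
  refine integral_verticalLine_eq (F := fun s => (x : ℂ) ^ (-s) * F s)
    (C := (x ^ (-σ₁) + x ^ (-σ₂)) * C) h ?_ ?_
  · refine DifferentiableOn.mul (fun s _ => ?_) (hd.mono fun s hs => ⟨?_, ?_⟩)
    · exact ((differentiableAt_id.neg).const_cpow (Or.inl hx')).differentiableWithinAt
    · exact h₁.trans_le hs.1
    · exact lt_of_le_of_lt hs.2 h₂
  · intro s hs
    rw [norm_mul, norm_cpow_eq_rpow_re_of_pos hx, mul_assoc]
    refine mul_le_mul ?_ (hC s hs.1 hs.2) (norm_nonneg _) (by positivity)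
    have p1 := Real.rpow_pos_of_pos hx (-σ₁)
    have p2 := Real.rpow_pos_of_pos hx (-σ₂)
    rcases le_total 1 x with h1 | h1
    · have := Real.rpow_le_rpow_of_exponent_le h1 (neg_le_neg hs.1)
      simp only [neg_re]; linarith
    · have := Real.rpow_le_rpow_of_exponent_ge hx h1 (neg_le_neg hs.2)
      simp only [neg_re]; linarith

theorem mellinInv_eq' (hF : HasVerticalDecay F a b)
    (hd : DifferentiableOn ℂ F (re ⁻¹' Ioo a b)) {σ₁ σ₂ : ℝ} (h₁ : σ₁ ∈ Ioo a b)
    (h₂ : σ₂ ∈ Ioo a b) {x : ℝ} (hx : 0 < x) : mellinInv σ₁ F x = mellinInv σ₂ F x := by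
  rcases le_total σ₁ σ₂ with h | h
  · exact hF.mellinInv_eq hd h₁.1 h h₂.2 hx
  · exact (hF.mellinInv_eq hd h₂.1 h h₁.2 hx).symm

/-- Moving the contour to `Re s = σ` pulls out `x ^ (-σ)`. Since `σ` is free, this controls the
inverse transform both at `0` and at infinity. -/
theorem exists_norm_mellinInv_le (hF : HasVerticalDecay F a b)
    (hd : DifferentiableOn ℂ F (re ⁻¹' Ioo a b)) {γ σ : ℝ} (hγ : γ ∈ Ioo a b)
    (hσ : σ ∈ Ioo a b) : ∃ C : ℝ, ∀ x : ℝ, 0 < x → ‖mellinInv γ F x‖ ≤ C * x ^ (-σ) := by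
  refine ⟨‖(1 / (2 * Real.pi) : ℝ)‖ * ∫ y : ℝ, ‖F (σ + y * I)‖, fun x hx => ?_⟩
  rw [hF.mellinInv_eq' hd hγ hσ hx, mellinInv, norm_smul, mul_assoc, ← integral_mul_const]
  refine mul_le_mul_of_nonneg_left ((norm_integral_le_integral_norm _).trans (le_of_eq ?_))
    (norm_nonneg _)
  congr 1 with y
  rw [norm_smul, norm_cpow_eq_rpow_re_of_pos hx, mul_comm]
  simp

theorem continuous_scaled_line (hd : DifferentiableOn ℂ F (re ⁻¹' Ioo a b)) {σ : ℝ}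
    (hσ : σ ∈ Ioo a b) : Continuous fun y : ℝ => F (σ + 2 * Real.pi * y * I) :=
  hd.continuousOn.comp_continuous (by fun_prop) fun y => by simpa using hσ

theorem integrable_scaled_line (hF : HasVerticalDecay F a b)
    (hd : DifferentiableOn ℂ F (re ⁻¹' Ioo a b)) {σ : ℝ} (hσ : σ ∈ Ioo a b) :
    Integrable fun y : ℝ => F (σ + 2 * Real.pi * y * I) := by
  have := (hF.integrable_line hd hσ.1 hσ.2).comp_mul_left' (R := 2 * Real.pi) (by positivity)
  simpa using this

open scoped FourierTransform in
theorem continuousOn_mellinInv (hF : HasVerticalDecay F a b)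
    (hd : DifferentiableOn ℂ F (re ⁻¹' Ioo a b)) {γ : ℝ} (hγ : γ ∈ Ioo a b) :
    ContinuousOn (mellinInv γ F) (Ioi 0) := by
  have hc : Continuous (𝓕⁻ fun y : ℝ => F (γ + 2 * Real.pi * y * I)) := by
    have : Continuous (𝓕 fun y : ℝ => F (γ + 2 * Real.pi * y * I)) :=
      VectorFourier.fourierIntegral_continuous Real.continuous_fourierChar
        (by fun_prop) (hF.integrable_scaled_line hd hγ)
    have h2 : (𝓕⁻ fun y : ℝ => F (γ + 2 * Real.pi * y * I)) =
        fun x => (𝓕 fun y : ℝ => F (γ + 2 * Real.pi * y * I)) (-x) := by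
      ext x
      rw [Real.fourierInv_eq_fourier_neg]
    rw [h2]
    exact this.comp continuous_neg
  refine ContinuousOn.congr (f := fun x : ℝ => (x : ℂ) ^ (-γ : ℂ) *
    (𝓕⁻ fun y : ℝ => F (γ + 2 * Real.pi * y * I)) (-Real.log x)) ?_
    fun x hx => mellinInv_eq_fourierInv γ F hx
  refine ContinuousOn.mul (fun x hx => ?_) ?_
  · refine ContinuousAt.continuousWithinAt ?_
    exact (continuousAt_cpow_const (Or.inl (by simpa using hx))).comp
      continuous_ofReal.continuousAt
  · exact hc.comp_continuousOn ((Real.continuousOn_log.mono fun x hx => ne_of_gt hx).neg)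

theorem mellinConvergent_mellinInv (hF : HasVerticalDecay F a b)
    (hd : DifferentiableOn ℂ F (re ⁻¹' Ioo a b)) {γ : ℝ} (hγ : γ ∈ Ioo a b) {δ : ℂ}
    (hδ : δ.re ∈ Ioo a b) : MellinConvergent (mellinInv γ F) δ := by
  -- With `u < Re δ < v`, the bound `x ^ (-u)` serves near `0` and `x ^ (-v)` near infinity.
  obtain ⟨u, hu1, hu2⟩ := exists_between hδ.1
  obtain ⟨v, hv1, hv2⟩ := exists_between hδ.2
  obtain ⟨C, hC⟩ := hF.exists_norm_mellinInv_le hd hγ ⟨hu1, hu2.trans hδ.2⟩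
  obtain ⟨D, hD⟩ := hF.exists_norm_mellinInv_le hd hγ ⟨hδ.1.trans hv1, hv2⟩
  refine mellinConvergent_of_isBigO_rpow (a := v) (b := u)
    ((hF.continuousOn_mellinInv hd hγ).locallyIntegrableOn measurableSet_Ioi) ?_ hv1 ?_ hu2
  · refine Asymptotics.IsBigO.of_bound D ?_
    filter_upwards [eventually_gt_atTop (0 : ℝ)] with x hx
    rw [Real.norm_of_nonneg (Real.rpow_nonneg hx.le _)]
    exact hD x hx
  · refine Asymptotics.IsBigO.of_bound C ?_
    filter_upwards [self_mem_nhdsWithin] with x (hx : 0 < x)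
    rw [Real.norm_of_nonneg (Real.rpow_nonneg hx.le _)]
    exact hC x hx

open scoped FourierTransform in
/-- Mellin inversion starting from the transform: `F` is the Mellin transform of its inverse
Mellin transform, throughout the strip. -/
theorem mellin_mellinInv (hF : HasVerticalDecay F a b)
    (hd : DifferentiableOn ℂ F (re ⁻¹' Ioo a b)) {γ : ℝ} (hγ : γ ∈ Ioo a b) {δ : ℂ}
    (hδ : δ.re ∈ Ioo a b) : mellin (mellinInv γ F) δ = F δ := by
  set g : ℝ → ℂ := fun y => F (δ.re + 2 * Real.pi * y * I) with hg
  -- After moving the contour to `Re s = Re δ`, the substitution `x = exp (-u)` turns Mellin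
  -- inversion into Fourier inversion for `g`.
  have key : ∀ u : ℝ, Real.exp (-δ.re * u) • mellinInv γ F (Real.exp (-u)) = (𝓕⁻ g) u := by
    intro u
    rw [hF.mellinInv_eq' hd hγ hδ (Real.exp_pos _), mellinInv_eq_fourierInv _ _ (Real.exp_pos _),
      Real.log_exp, neg_neg, ← ofReal_neg, ← ofReal_cpow (Real.exp_pos _).le, ← Real.exp_mul,
      real_smul, smul_eq_mul, ← mul_assoc, ← ofReal_mul, ← Real.exp_add,
      show -δ.re * u + -u * -δ.re = 0 by ring]
    simp [hg]
  -- Fourier inversion requires an integrable transform; under `x = exp (-u)` this is the Mellin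
  -- convergence already obtained.
  have hint : Integrable (𝓕⁻ g) := by
    have h1 : IntegrableOn (fun t : ℝ => (t : ℂ) ^ (δ - 1) • mellinInv γ F t)
        ((fun u : ℝ => Real.exp (-u)) '' univ) := by
      have : (fun u : ℝ => Real.exp (-u)) '' univ = Ioi 0 := by
        rw [image_univ, ← Real.range_exp]
        exact neg_surjective.range_comp Real.exp
      rw [this]
      exact hF.mellinConvergent_mellinInv hd hγ hδ
    rw [integrableOn_image_iff_integrableOn_abs_deriv_smul MeasurableSet.univ
      (f := fun u => Real.exp (-u)) (f' := fun u => -Real.exp (-u))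
      (fun x _ => by simpa using (hasDerivAt_neg x).exp)
      ((Real.exp_injective.comp neg_injective).injOn), integrableOn_univ] at h1
    refine h1.norm.mono' ?_ (ae_of_all _ fun u => ?_)
    · refine Continuous.aestronglyMeasurable ?_
      simp_rw [← funext key]
      refine Continuous.smul (f := fun u : ℝ => Real.exp (-δ.re * u))
        (g := fun u => mellinInv γ F (Real.exp (-u))) (by fun_prop) ?_
      exact (hF.continuousOn_mellinInv hd hγ).comp_continuous (by fun_prop)
        fun u => Real.exp_pos _
    · rw [← key, norm_smul, norm_smul, norm_smul, norm_cpow_eq_rpow_re_of_pos (Real.exp_pos _),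
        ← Real.exp_mul, ← mul_assoc]
      refine mul_le_mul_of_nonneg_right (le_of_eq ?_) (norm_nonneg _)
      rw [abs_neg, Real.norm_eq_abs, Real.norm_eq_abs, abs_abs, abs_of_pos (Real.exp_pos _),
        abs_of_pos (Real.exp_pos _), ← Real.exp_add]
      congr 1
      simp
      ring
  have hint' : Integrable (𝓕 g) := by
    have h2 : 𝓕 g = fun u => (𝓕⁻ g) (-u) := by
      ext u
      rw [Real.fourierInv_eq_fourier_neg, neg_neg]
    rw [h2]
    exact hint.comp_neg
  rw [mellin_eq_fourier, funext key, (continuous_scaled_line hd hδ).fourier_fourierInv_eq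
    (hF.integrable_scaled_line hd hδ) hint']
  beta_reduce
  congr 1
  conv_rhs => rw [← re_add_im δ]
  have : (Real.pi : ℂ) ≠ 0 := ofReal_ne_zero.2 Real.pi_ne_zero
  push_cast
  field_simp

end HasVerticalDecay

/-! ### Integrals of even functions. -/

open Set in
theorem MeasureTheory.IntegrableOn.integrable_comp_abs {E : Type*} [NormedAddCommGroup E]
    {f : ℝ → E} (hf : IntegrableOn f (Ioi 0)) : Integrable fun x : ℝ => f |x| := by
  have h1 : IntegrableOn (fun x => f |x|) (Ioi 0) :=
    hf.congr_fun (fun x hx => by rw [abs_of_pos hx]) measurableSet_Ioi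
  have h2 : IntegrableOn (fun x => f |x|) (Iic 0) := by
    rw [← Measure.map_neg_eq_self (volume : Measure ℝ)]
    let m : MeasurableEmbedding fun x : ℝ => -x := (Homeomorph.neg ℝ).measurableEmbedding
    rw [m.integrableOn_map_iff]
    simp_rw [Function.comp_def, abs_neg, neg_preimage, neg_Iic, neg_zero]
    exact (integrableOn_Ici_iff_integrableOn_Ioi).2 h1
  rw [← integrableOn_univ, ← Iic_union_Ioi (a := (0 : ℝ))]
  exact h2.union h1

open Set in
theorem MeasureTheory.IntegrableOn.integral_comp_abs {E : Type*} [NormedAddCommGroup E]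
    [NormedSpace ℝ E] {f : ℝ → E} (hf : IntegrableOn f (Ioi 0)) :
    ∫ x : ℝ, f |x| = (2 : ℝ) • ∫ x in Ioi (0 : ℝ), f x := by
  have h := hf.integrable_comp_abs
  have h1 : ∫ x in Ioi (0 : ℝ), f |x| = ∫ x in Ioi (0 : ℝ), f x :=
    setIntegral_congr_fun measurableSet_Ioi fun x hx => by rw [abs_of_pos hx]
  have h2 : ∫ x in Iic (0 : ℝ), f |x| = ∫ x in Ioi (0 : ℝ), f x := by
    have := integral_comp_neg_Iic (0 : ℝ) f
    rw [neg_zero] at this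
    rw [← this]
    exact setIntegral_congr_fun measurableSet_Iic fun x hx => by rw [abs_of_nonpos hx]
  rw [← setIntegral_univ, ← Iic_union_Ioi (a := (0 : ℝ)),
    setIntegral_union (Iic_disjoint_Ioi le_rfl) measurableSet_Ioi h.integrableOn h.integrableOn,
    h1, h2, two_smul]

/-! ### Vertical estimates for the sine and gamma functions. -/

namespace Complex

theorem norm_sin_le_exp_abs_im (z : ℂ) : ‖sin z‖ ≤ Real.exp |z.im| := by
  have h1 : ‖exp (-z * I)‖ ≤ Real.exp |z.im| := by
    rw [norm_exp]; simpa using le_abs_self z.im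
  have h2 : ‖exp (z * I)‖ ≤ Real.exp |z.im| := by
    rw [norm_exp]; simpa using neg_le_abs z.im
  rw [sin, norm_div, norm_mul, norm_I, mul_one, Complex.norm_ofNat]
  have := norm_sub_le (exp (-z * I)) (exp (z * I))
  linarith

theorem exp_abs_im_sub_le_norm_sin (z : ℂ) :
    (Real.exp |z.im| - Real.exp (-|z.im|)) / 2 ≤ ‖sin z‖ := by
  have h1 : ‖exp (-z * I)‖ = Real.exp z.im := by rw [norm_exp]; simp
  have h2 : ‖exp (z * I)‖ = Real.exp (-z.im) := by rw [norm_exp]; simp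
  rw [sin, norm_div, norm_mul, norm_I, mul_one, Complex.norm_ofNat]
  have h3 := abs_norm_sub_norm_le (exp (-z * I)) (exp (z * I))
  rw [h1, h2] at h3
  refine div_le_div_of_nonneg_right (le_trans ?_ h3) zero_le_two
  rcases abs_cases z.im with ⟨h, _⟩ | ⟨h, _⟩
  · rw [h]; exact le_abs_self _
  · rw [h, neg_neg, ← neg_sub]; exact neg_le_abs _

theorem norm_inv_sin_le {v : ℝ} (hv : 0 < v) :
    ∃ C : ℝ, 0 < C ∧ ∀ z : ℂ, v ≤ |z.im| → ‖(sin z)⁻¹‖ ≤ C * Real.exp (-|z.im|) := by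
  have hlt : Real.exp (-(2 * v)) < 1 := by rw [Real.exp_lt_one_iff]; linarith
  have h0 : 0 < (1 - Real.exp (-(2 * v))) / 2 := by linarith
  refine ⟨((1 - Real.exp (-(2 * v))) / 2)⁻¹, inv_pos.2 h0, fun z hz => ?_⟩
  rw [norm_inv, Real.exp_neg |z.im|, ← mul_inv]
  refine inv_anti₀ (by positivity) (le_trans ?_ (exp_abs_im_sub_le_norm_sin z))
  have h1 : Real.exp (-|z.im|) ≤ Real.exp (-(2 * v)) * Real.exp |z.im| := by
    rw [← Real.exp_add]; exact Real.exp_le_exp.2 (by linarith)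
  linarith

end Complex

/-- This is the modulus of the gamma integrand after `x = exp (-y)`, with `c` the cosine of the
rotation angle. For `y → ∞` the bound `σ ≥ σ₁ > 0` gives decay; for `y → -∞` the double exponential
wins. -/
theorem Real.exp_neg_mul_sub_mul_exp_neg_le {σ₁ σ₂ c : ℝ} (hσ : 0 < σ₁) (hc : 0 < c) :
    ∃ C : ℝ, 0 < C ∧ ∀ σ y : ℝ, σ₁ ≤ σ → σ ≤ σ₂ →
      Real.exp (-σ * y - c * Real.exp (-y)) ≤ C * (1 + y ^ 2)⁻¹ := by
  set A := 1 + 2 / σ₁ ^ 2 with hA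
  set B := 2 * Real.exp ((σ₂ + 1) ^ 2 / (2 * c)) with hB
  have hA0 : 0 < A := by positivity
  have hB0 : 0 < B := by positivity
  refine ⟨A + B, by positivity, fun σ y h1 h2 => ?_⟩
  rw [← div_eq_mul_inv, le_div_iff₀ (by positivity)]
  rcases le_total 0 y with hy | hy
  · have e1 := Real.quadratic_le_exp_of_nonneg (mul_nonneg hσ.le hy)
    have e2 : Real.exp (-σ * y - c * Real.exp (-y)) ≤ (Real.exp (σ₁ * y))⁻¹ := by
      rw [← Real.exp_neg]
      refine Real.exp_le_exp.2 ?_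
      have := mul_pos hc (Real.exp_pos (-y))
      nlinarith
    have e3 : 1 + y ^ 2 ≤ A * Real.exp (σ₁ * y) := by
      have : A * (1 + (σ₁ * y) ^ 2 / 2) ≤ A * Real.exp (σ₁ * y) := by
        refine mul_le_mul_of_nonneg_left ?_ hA0.le
        have := mul_nonneg hσ.le hy
        linarith
      have e4 : A * (1 + (σ₁ * y) ^ 2 / 2) =
          1 + y ^ 2 + (2 / σ₁ ^ 2 + (σ₁ * y) ^ 2 / 2) := by
        rw [hA]; field_simp; ring
      have : 0 ≤ 2 / σ₁ ^ 2 + (σ₁ * y) ^ 2 / 2 := by positivity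
      linarith
    calc _ ≤ (Real.exp (σ₁ * y))⁻¹ * (A * Real.exp (σ₁ * y)) :=
          mul_le_mul e2 e3 (by positivity) (by positivity)
      _ = A := by field_simp
      _ ≤ A + B := by linarith
  · obtain ⟨u, rfl⟩ : ∃ u, y = -u := ⟨-y, by ring⟩
    have hu : 0 ≤ u := by linarith
    have e1 := Real.quadratic_le_exp_of_nonneg hu
    have e3 : 1 + (-u) ^ 2 ≤ 2 * Real.exp u := by nlinarith
    have e2 : Real.exp (-σ * -u - c * Real.exp (- -u)) ≤
        Real.exp ((σ₂ + 1) ^ 2 / (2 * c)) * (Real.exp u)⁻¹ := by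
      rw [← Real.exp_neg, ← Real.exp_add]
      refine Real.exp_le_exp.2 ?_
      have e4 : c * (u ^ 2 / 2) ≤ c * Real.exp u :=
        mul_le_mul_of_nonneg_left (by nlinarith) hc.le
      -- Completing the square explains the constant in `B`; the extra `1` in `σ₂ + 1` leaves a
      -- factor `exp (-u)` to absorb `1 + u ^ 2`.
      have e5 : (σ₂ + 1) * u ≤ (σ₂ + 1) ^ 2 / (2 * c) + c * (u ^ 2 / 2) := by
        have e6 : (σ₂ + 1) ^ 2 / (2 * c) + c * (u ^ 2 / 2) - (σ₂ + 1) * u =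
            (σ₂ + 1 - c * u) ^ 2 / (2 * c) := by field_simp; ring
        have : 0 ≤ (σ₂ + 1 - c * u) ^ 2 / (2 * c) := by positivity
        linarith
      rw [neg_neg]
      nlinarith [mul_le_mul_of_nonneg_right h2 hu]
    calc _ ≤ Real.exp ((σ₂ + 1) ^ 2 / (2 * c)) * (Real.exp u)⁻¹ * (2 * Real.exp u) :=
          mul_le_mul e2 e3 (by positivity) (by positivity)
      _ = B := by rw [hB]; field_simp
      _ ≤ A + B := by linarith

namespace Complex

open scoped FourierTransform in
theorem Gamma_eq_integral_exp {s : ℂ} (hs : 0 < s.re) :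
    Gamma s = ∫ y : ℝ, exp (-s * y - Real.exp (-y)) := by
  rw [Gamma_eq_integral hs, GammaIntegral_eq_mellin, mellin_eq_fourier, Real.fourier_eq']
  congr 1 with y
  simp only [smul_eq_mul, real_smul]
  rw [ofReal_exp, ofReal_exp, ← exp_add, ← exp_add]
  congr 1
  have hpi : (Real.pi : ℂ) ≠ 0 := ofReal_ne_zero.2 Real.pi_ne_zero
  have hs' := re_add_im s
  simp
  field_simp
  linear_combination (-(y : ℂ)) * hs'

/-- The rotated gamma integrand `exp (s w - exp w)` along the line `Im w = v`, `w = i ζ`. -/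
theorem norm_exp_mul_I_sub_exp (s ζ : ℂ) :
    ‖exp (s * (I * ζ) - exp (I * ζ))‖ =
      Real.exp (-s.im * ζ.re) *
        Real.exp (-s.re * ζ.im - Real.cos ζ.re * Real.exp (-ζ.im)) := by
  rw [norm_exp, ← Real.exp_add]
  congr 1
  simp [exp_re]
  ring

/-- Exponential decay of the gamma function along vertical lines, at any rate below `π / 2`. -/
theorem norm_Gamma_le {σ₁ σ₂ θ : ℝ} (hσ : 0 < σ₁) (hθ0 : 0 ≤ θ) (hθ : θ < Real.pi / 2) :
    ∃ C : ℝ, 0 < C ∧ ∀ s : ℂ, σ₁ ≤ s.re → s.re ≤ σ₂ →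
      ‖Gamma s‖ ≤ C * Real.exp (-θ * |s.im|) := by
  have hcos : 0 < Real.cos θ := Real.cos_pos_of_mem_Ioo ⟨by linarith, hθ⟩
  obtain ⟨C, hC0, hC⟩ := Real.exp_neg_mul_sub_mul_exp_neg_le (σ₂ := σ₂) hσ hcos
  have hI : 0 ≤ ∫ y : ℝ, C * (1 + y ^ 2)⁻¹ := integral_nonneg fun y => by positivity
  refine ⟨(∫ y : ℝ, C * (1 + y ^ 2)⁻¹) + 1, by linarith, fun s h1 h2 => ?_⟩
  set F : ℂ → ℂ := fun ζ => exp (s * (I * ζ) - exp (I * ζ)) with hF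
  have hd : Differentiable ℂ F := by fun_prop
  have hb : ∀ ζ : ℂ, ζ.re ∈ Set.Icc (-θ) θ → ‖F ζ‖ ≤
      Real.exp (-s.im * ζ.re) * (C * (1 + ζ.im ^ 2)⁻¹) := by
    intro ζ hζ
    rw [hF]
    beta_reduce
    rw [norm_exp_mul_I_sub_exp]
    refine mul_le_mul_of_nonneg_left (le_trans (Real.exp_le_exp.2 ?_) (hC s.re ζ.im h1 h2))
      (Real.exp_pos _).le
    have : Real.cos θ ≤ Real.cos ζ.re := by
      rw [← Real.cos_abs ζ.re]
      exact Real.cos_le_cos_of_nonneg_of_le_pi (abs_nonneg _) (by linarith [Real.pi_pos])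
        (abs_le.2 hζ)
    have := mul_le_mul_of_nonneg_right this (Real.exp_pos (-ζ.im)).le
    linarith
  have hb' : ∀ ζ : ℂ, ζ.re ∈ Set.Icc (-θ) θ → ‖F ζ‖ ≤
      (Real.exp (|s.im| * θ) * C) * (1 + ζ.im ^ 2)⁻¹ := by
    intro ζ hζ
    refine (hb ζ hζ).trans ?_
    rw [mul_assoc]
    refine mul_le_mul_of_nonneg_right (Real.exp_le_exp.2 ?_) (by positivity)
    calc -s.im * ζ.re ≤ |-s.im * ζ.re| := le_abs_self _
      _ = |s.im| * |ζ.re| := by rw [abs_mul, abs_neg]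
      _ ≤ |s.im| * θ := mul_le_mul_of_nonneg_left (abs_le.2 hζ) (abs_nonneg _)
  -- Euler's integral may be taken along the ray of argument `v`, which in logarithmic coordinates
  -- is a shift of the line.
  have hline : ∀ v ∈ Set.Icc (-θ) θ, Gamma s = ∫ y : ℝ, F (v + y * I) := by
    intro v hv
    have h0 : Gamma s = ∫ y : ℝ, F ((0 : ℝ) + y * I) := by
      rw [Gamma_eq_integral_exp (hσ.trans_le h1)]
      congr 1 with y
      have : I * (((0 : ℝ) : ℂ) + y * I) = -y := by
        push_cast
        linear_combination (y : ℂ) * I_mul_I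
      rw [hF]
      beta_reduce
      rw [this]
      push_cast
      ring_nf
    rw [h0]
    rcases le_total 0 v with h | h
    · exact integral_verticalLine_eq h hd.differentiableOn
        fun ζ hζ => hb' ζ ⟨(by linarith [hζ.1]), hζ.2.trans hv.2⟩
    · exact (integral_verticalLine_eq h hd.differentiableOn
        fun ζ hζ => hb' ζ ⟨hv.1.trans hζ.1, hζ.2.trans hθ0⟩).symm
  -- The rotation goes in the direction given by the sign of `Im s`, so that the factor `exp (-Im s
  -- * v)` is as small as possible.
  obtain ⟨v, hv, hvs⟩ : ∃ v ∈ Set.Icc (-θ) θ, -s.im * v = -θ * |s.im| := by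
    rcases abs_cases s.im with ⟨h, _⟩ | ⟨h, _⟩
    · exact ⟨θ, ⟨by linarith, le_rfl⟩, by rw [h]; ring⟩
    · exact ⟨-θ, ⟨le_rfl, by linarith⟩, by rw [h]; ring⟩
  rw [hline v hv]
  have hfin : ‖∫ y : ℝ, F (v + y * I)‖ ≤
      ∫ y : ℝ, Real.exp (-θ * |s.im|) * (C * (1 + y ^ 2)⁻¹) := by
    refine norm_integral_le_of_norm_le
      ((integrable_inv_one_add_sq.const_mul C).const_mul _) (ae_of_all _ fun y => ?_)
    have := hb (v + y * I) (by simpa using hv)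
    simpa [hvs] using this
  rw [integral_const_mul] at hfin
  have := Real.exp_pos (-θ * |s.im|)
  linarith

/-- Each factor `z + k` of the functional equation has modulus at least `1`. This moves the argument
to the right half-plane, where `norm_Gamma_le` applies. -/
theorem norm_Gamma_le_norm_Gamma_add_nat (n : ℕ) {z : ℂ} (hz : 1 ≤ |z.im|) :
    ‖Gamma z‖ ≤ ‖Gamma (z + n)‖ := by
  induction n with
  | zero => simp
  | succ n ih =>
    refine ih.trans ?_
    have h1 : 1 ≤ ‖z + n‖ := by
      refine hz.trans ?_
      simpa using abs_im_le_norm (z + n)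
    have h0 : z + n ≠ 0 := fun h => by rw [h, norm_zero] at h1; linarith
    rw [Nat.cast_succ, ← add_assoc, Gamma_add_one _ h0, norm_mul]
    exact le_mul_of_one_le_left (norm_nonneg _) h1

/-- Growth of `1 / Γ` along vertical lines, at any exponential rate above `π / 2`. -/
theorem norm_inv_Gamma_le (σ₁ σ₂ : ℝ) {θ : ℝ} (hθ0 : 0 ≤ θ) (hθ : θ < Real.pi / 2) :
    ∃ C : ℝ, 0 < C ∧ ∀ s : ℂ, σ₁ ≤ s.re → s.re ≤ σ₂ → 1 ≤ |s.im| →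
      ‖(Gamma s)⁻¹‖ ≤ C * Real.exp ((Real.pi - θ) * |s.im|) := by
  obtain ⟨n, hn⟩ := exists_nat_ge σ₂
  obtain ⟨C, hC0, hC⟩ := norm_Gamma_le (σ₁ := 1 - σ₂ + n) (σ₂ := 1 - σ₁ + n) (by linarith) hθ0 hθ
  refine ⟨C * Real.pi⁻¹, by positivity, fun s h1 h2 h3 => ?_⟩
  have him : s.im ≠ 0 := fun h => by rw [h, abs_zero] at h3; linarith
  have hpi : (Real.pi : ℂ) ≠ 0 := ofReal_ne_zero.2 Real.pi_ne_zero
  have hsin : sin (Real.pi * s) ≠ 0 := by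
    rw [Ne, sin_eq_zero_iff]
    rintro ⟨k, hk⟩
    have := congrArg im hk
    simp [him, Real.pi_ne_zero] at this
  have hG : Gamma s ≠ 0 := by
    refine Gamma_ne_zero fun m h => him ?_
    rw [h]; simp
  -- Reflection trades the lower bound on `Γ(s)` for upper bounds: rate `-θ` from `Γ(1 - s)` and `π`
  -- from the sine.
  have heq : (Gamma s)⁻¹ = Gamma (1 - s) * sin (Real.pi * s) * (Real.pi : ℂ)⁻¹ := by
    have := Gamma_mul_Gamma_one_sub s
    rw [eq_div_iff hsin, mul_comm (Real.pi : ℂ) s] at this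
    field_simp
    linear_combination -this
  have hb1 : ‖Gamma (1 - s)‖ ≤ C * Real.exp (-θ * |s.im|) := by
    refine (norm_Gamma_le_norm_Gamma_add_nat n (by simpa using h3)).trans ?_
    have := hC (1 - s + n) (by simp; linarith) (by simp; linarith)
    simpa using this
  have hb2 : ‖sin (Real.pi * s)‖ ≤ Real.exp (Real.pi * |s.im|) := by
    refine (norm_sin_le_exp_abs_im _).trans (le_of_eq ?_)
    rw [im_ofReal_mul, abs_mul, abs_of_pos Real.pi_pos]
  rw [heq, norm_mul, norm_mul, norm_inv, norm_real, Real.norm_of_nonneg Real.pi_pos.le]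
  calc _ ≤ C * Real.exp (-θ * |s.im|) * Real.exp (Real.pi * |s.im|) * Real.pi⁻¹ := by gcongr
    _ = _ := by
      rw [mul_assoc C, ← Real.exp_add]
      ring_nf

end Complex

/-! ### The kernel of the solution, its decay, and the moments. -/

namespace FractionalDiffusion

open Complex

theorem AdmissibleLine.mem_Ioo {α β γ : ℝ} (h : AdmissibleLine α β γ) :
    γ ∈ Set.Ioo (-min 1 α) 0 := by
  have h1 := h.1 0 (by norm_num) 0
  have h2 := h.1 1 (by norm_num) 0
  have h3 := h.2 0 (by norm_num) 0
  simp [lower, lowerScale, upper, upperScale] at h1 h2 h3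
  refine ⟨?_, h3⟩
  rcases min_choice 1 α with h | h <;> rw [h] <;> assumption

/-- The Mellin-Barnes kernel of the H-function in `solution`. -/
noncomputable def solutionKernel (α β : ℝ) (ξ : ℂ) : ℂ :=
  FoxH.kernel 2 1 (upper β) (upperScale α β) lower (lowerScale α) ξ

theorem solutionKernel_eq (α β : ℝ) (ξ : ℂ) : solutionKernel α β ξ =
    Gamma (-(ξ / α)) * Gamma (1 + ξ) * Gamma (1 + ξ / α) /
      (Gamma (-(ξ / 2)) * Gamma (β + β * ξ / α) * Gamma (1 + ξ / 2)) := by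
  simp only [solutionKernel, FoxH.kernel, Finset.prod_filter, Fin.prod_univ_three]
  simp [lower, lowerScale, upper, upperScale]
  ring_nf

theorem Gamma_one_add_mul_Gamma_neg (z : ℂ) :
    Gamma (1 + z) * Gamma (-z) = -(Real.pi / sin (Real.pi * z)) := by
  have := Gamma_mul_Gamma_one_sub (1 + z)
  rw [show (1 : ℂ) - (1 + z) = -z by ring, show (Real.pi : ℂ) * (1 + z) =
    Real.pi * z + Real.pi by ring, sin_add_pi, div_neg] at this
  exact this

theorem solutionKernel_eq_sin (α β : ℝ) (ξ : ℂ) : solutionKernel α β ξ =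
    Gamma (1 + ξ) * sin (Real.pi * (ξ / 2)) * (sin (Real.pi * (ξ / α)))⁻¹ *
      (Gamma (β + β * ξ / α))⁻¹ := by
  have hpi : (Real.pi : ℂ) ≠ 0 := ofReal_ne_zero.2 Real.pi_ne_zero
  have h1 := Gamma_one_add_mul_Gamma_neg (ξ / α)
  have h2 := Gamma_one_add_mul_Gamma_neg (ξ / 2)
  calc solutionKernel α β ξ = Gamma (1 + ξ) * (Gamma (1 + ξ / α) * Gamma (-(ξ / α))) *
        (Gamma (1 + ξ / 2) * Gamma (-(ξ / 2)))⁻¹ * (Gamma (β + β * ξ / α))⁻¹ := by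
        rw [solutionKernel_eq, div_eq_mul_inv, mul_inv, mul_inv, mul_inv]
        ring
    _ = _ := by
        rw [h1, h2, inv_neg, inv_div, div_eq_mul_inv, div_eq_mul_inv]
        field_simp

/-- The four factors have rates `-(π/2 - ε)`, `π/2`, `-π/α` and `(π/2 + ε)β/α`. Their sum is `-(q -
ε)(α + β)/α`, so any `ε < q` will do, and `q > 0` because `β < 2`. -/
theorem solutionKernel_bound {α β σ₁ σ₂ : ℝ} (hα : 0 < α) (hβ0 : 0 < β) (hβ2 : β < 2)
    (hσ : -1 < σ₁) : ∃ C κ Y : ℝ, 0 < C ∧ 0 < κ ∧ 0 < Y ∧ ∀ s : ℂ, σ₁ ≤ s.re → s.re ≤ σ₂ →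
      Y ≤ |s.im| → ‖solutionKernel α β s‖ ≤ C * Real.exp (-κ * |s.im|) := by
  have hpi := Real.pi_pos
  set q := Real.pi * (1 - β / 2) / (α + β) with hq
  have hq0 : 0 < q := div_pos (mul_pos hpi (by linarith)) (by linarith)
  set ε := min (Real.pi / 2) (q / 2) with hε
  have hε0 : 0 < ε := lt_min (by positivity) (by positivity)
  have hεq : ε < q := (min_le_right _ _).trans_lt (by linarith)
  have hεp : ε ≤ Real.pi / 2 := min_le_left _ _
  obtain ⟨C₁, hC₁, h₁⟩ := norm_Gamma_le (σ₁ := 1 + σ₁) (σ₂ := 1 + σ₂) (θ := Real.pi / 2 - ε)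
    (by linarith) (by linarith) (by linarith)
  obtain ⟨C₂, hC₂, h₂⟩ := norm_inv_sin_le (v := Real.pi / α) (by positivity)
  obtain ⟨C₃, hC₃, h₃⟩ := norm_inv_Gamma_le (β + β * σ₁ / α) (β + β * σ₂ / α)
    (θ := Real.pi / 2 - ε) (by linarith) (by linarith)
  -- In the threshold, `1` keeps `πs/α` away from the real axis and `α / β` makes `|Im (β + βs/α)| ≥
  -- 1`.
  refine ⟨C₁ * C₂ * C₃, (q - ε) * (α + β) / α, max 1 (α / β), by positivity,
    div_pos (mul_pos (by linarith) (by linarith)) hα, by positivity, fun s hs1 hs2 hs => ?_⟩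
  have hs' : 1 ≤ |s.im| := (le_max_left _ _).trans hs
  have hs'' : α / β ≤ |s.im| := (le_max_right _ _).trans hs
  have hre : ((β : ℂ) + β * s / α).re = β + β * s.re / α := by
    rw [add_re, div_ofReal_re, re_ofReal_mul, ofReal_re]
  have him : ((β : ℂ) + β * s / α).im = β * s.im / α := by
    rw [add_im, div_ofReal_im, im_ofReal_mul, ofReal_im, zero_add]
  have habs : |β * s.im / α| = β * |s.im| / α := by
    rw [abs_div, abs_mul, abs_of_pos hβ0, abs_of_pos hα]
  have e1 : ‖Gamma (1 + s)‖ ≤ C₁ * Real.exp (-(Real.pi / 2 - ε) * |s.im|) := by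
    simpa using h₁ (1 + s) (by simpa using hs1) (by simpa using hs2)
  have e2 : ‖sin (Real.pi * (s / 2))‖ ≤ Real.exp (Real.pi / 2 * |s.im|) := by
    refine (norm_sin_le_exp_abs_im _).trans (le_of_eq ?_)
    have : (s / 2).im = s.im / 2 := by simp
    rw [im_ofReal_mul, this, abs_mul, abs_of_pos hpi, abs_div, abs_two]
    ring_nf
  have e3 : ‖(sin (Real.pi * (s / α)))⁻¹‖ ≤ C₂ * Real.exp (-(Real.pi / α * |s.im|)) := by
    have : |((Real.pi : ℂ) * (s / α)).im| = Real.pi / α * |s.im| := by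
      rw [im_ofReal_mul, div_ofReal_im, abs_mul, abs_of_pos hpi, abs_div, abs_of_pos hα]
      ring
    rw [← this]
    refine h₂ _ ?_
    rw [this]
    exact le_mul_of_one_le_right (by positivity) hs'
  have e4 : ‖(Gamma (β + β * s / α))⁻¹‖ ≤
      C₃ * Real.exp ((Real.pi - (Real.pi / 2 - ε)) * (β * |s.im| / α)) := by
    rw [← habs, ← him]
    refine h₃ _ ?_ ?_ ?_
    · rw [hre]; gcongr
    · rw [hre]; gcongr
    · rw [him, habs, le_div_iff₀ hα]
      rw [div_le_iff₀ hβ0] at hs''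
      linarith
  rw [solutionKernel_eq_sin, norm_mul, norm_mul, norm_mul]
  calc _ ≤ C₁ * Real.exp (-(Real.pi / 2 - ε) * |s.im|) * Real.exp (Real.pi / 2 * |s.im|) *
        (C₂ * Real.exp (-(Real.pi / α * |s.im|))) *
        (C₃ * Real.exp ((Real.pi - (Real.pi / 2 - ε)) * (β * |s.im| / α))) := by gcongr
    _ = C₁ * C₂ * C₃ * (Real.exp (-(Real.pi / 2 - ε) * |s.im|) * Real.exp (Real.pi / 2 * |s.im|) *
        Real.exp (-(Real.pi / α * |s.im|)) *
        Real.exp ((Real.pi - (Real.pi / 2 - ε)) * (β * |s.im| / α))) := by ring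
    _ = _ := by
      rw [← Real.exp_add, ← Real.exp_add, ← Real.exp_add]
      congr 2
      have : 0 < α + β := by linarith
      rw [hq]
      field_simp
      ring

/-- Compactness handles small `|Im s|` and the exponential bound the rest. Agreement is asked only
off the real axis, where all singularities of the kernel lie, so any continuation across them
qualifies. -/
theorem hasVerticalDecay_of_eq_solutionKernel {α β a b : ℝ} {F : ℂ → ℂ} (hα : 0 < α)
    (hβ0 : 0 < β) (hβ2 : β < 2) (ha : -1 ≤ a)
    (hd : DifferentiableOn ℂ F (re ⁻¹' Set.Ioo a b))
    (hF : ∀ s : ℂ, s.im ≠ 0 → F s = solutionKernel α β s) : HasVerticalDecay F a b := by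
  intro σ₁ σ₂ h₁ h₂
  obtain ⟨C, κ, Y, hC, hκ, hY, hb⟩ := solutionKernel_bound (σ₂ := σ₂) hα hβ0 hβ2
    (lt_of_le_of_lt ha h₁)
  have hK : IsCompact (Set.Icc σ₁ σ₂ ×ℂ Set.Icc (-Y) Y) := isCompact_Icc.reProdIm isCompact_Icc
  obtain ⟨D, hD⟩ := hK.exists_bound_of_continuousOn (f := F) (hd.continuousOn.mono fun s hs =>
    ⟨h₁.trans_le hs.1.1, lt_of_le_of_lt hs.1.2 h₂⟩)
  refine ⟨C * (1 + 2 / κ ^ 2) + |D| * (1 + Y ^ 2), fun s hs1 hs2 => ?_⟩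
  rw [← div_eq_mul_inv, le_div_iff₀ (by positivity)]
  rcases le_total Y |s.im| with h | h
  · have him : s.im ≠ 0 := fun h0 => by rw [h0, abs_zero] at h; linarith
    have e1 : 1 + s.im ^ 2 ≤ (1 + 2 / κ ^ 2) * Real.exp (κ * |s.im|) := by
      have := Real.quadratic_le_exp_of_nonneg (mul_nonneg hκ.le (abs_nonneg s.im))
      have h2 : (1 + 2 / κ ^ 2) * (1 + (κ * |s.im|) ^ 2 / 2) ≤
          (1 + 2 / κ ^ 2) * Real.exp (κ * |s.im|) := by
        refine mul_le_mul_of_nonneg_left ?_ (by positivity)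
        have := mul_nonneg hκ.le (abs_nonneg s.im)
        linarith
      have h3 : (1 + 2 / κ ^ 2) * (1 + (κ * |s.im|) ^ 2 / 2) =
          1 + s.im ^ 2 + (2 / κ ^ 2 + (κ * |s.im|) ^ 2 / 2) := by
        rw [mul_pow, sq_abs]; field_simp; ring
      have : 0 ≤ 2 / κ ^ 2 + (κ * |s.im|) ^ 2 / 2 := by positivity
      linarith
    rw [hF s him]
    calc _ ≤ C * Real.exp (-κ * |s.im|) * ((1 + 2 / κ ^ 2) * Real.exp (κ * |s.im|)) :=
          mul_le_mul (hb s hs1 hs2 h) e1 (by positivity) (by positivity)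
      _ = C * (1 + 2 / κ ^ 2) * (Real.exp (-κ * |s.im|) * Real.exp (κ * |s.im|)) := by ring
      _ = C * (1 + 2 / κ ^ 2) := by rw [← Real.exp_add]; simp
      _ ≤ _ := le_add_of_nonneg_right (by positivity)
  · have e1 : ‖F s‖ ≤ |D| := (hD s ⟨⟨hs1, hs2⟩, abs_le.1 h⟩).trans (le_abs_self D)
    have e2 : 1 + s.im ^ 2 ≤ 1 + Y ^ 2 := by
      rw [← sq_abs s.im]; gcongr
    calc _ ≤ |D| * (1 + Y ^ 2) := mul_le_mul e1 e2 (by positivity) (abs_nonneg _)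
      _ ≤ _ := le_add_of_nonneg_left (by positivity)

/-- A vertical line meets the real axis in one point, a null set, so a continuation may replace the
kernel. -/
theorem foxH_eq_mellinInv {α β γ : ℝ} {F : ℂ → ℂ}
    (hF : ∀ s : ℂ, s.im ≠ 0 → F s = solutionKernel α β s) (x : ℝ) :
    FoxH.H 2 1 (upper β) (upperScale α β) lower (lowerScale α) γ x = mellinInv γ F x := by
  have hpi : (Real.pi : ℂ) ≠ 0 := ofReal_ne_zero.2 Real.pi_ne_zero
  have : ∫ y : ℝ, FoxH.kernel 2 1 (upper β) (upperScale α β) lower (lowerScale α) (γ + y * I) *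
      (x : ℂ) ^ (-(γ + y * I)) * I = (∫ y : ℝ, (x : ℂ) ^ (-(γ + y * I)) • F (γ + y * I)) * I := by
    rw [← integral_mul_const]
    refine integral_congr_ae ?_
    filter_upwards [Measure.ae_ne volume (0 : ℝ)] with y hy
    rw [hF _ (by simpa using hy), solutionKernel, smul_eq_mul]
    ring
  rw [FoxH.H, this, mellinInv, real_smul]
  push_cast
  field_simp

theorem ofReal_scale_cpow {α β η t : ℝ} (hη : 0 < η) (ht : 0 < t) (δ : ℂ) :
    (((η * t ^ β) ^ (1 / α) : ℝ) : ℂ) ^ δ = (η : ℂ) ^ (δ / α) * (t : ℂ) ^ (β * (δ / α)) := by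
  have h0 : 0 < η * t ^ β := by positivity
  have hη' : (η : ℂ) ≠ 0 := ofReal_ne_zero.2 hη.ne'
  have ht' : (t : ℂ) ≠ 0 := ofReal_ne_zero.2 ht.ne'
  rw [cpow_def_of_ne_zero (ofReal_ne_zero.2 (by positivity)), cpow_def_of_ne_zero hη',
    cpow_def_of_ne_zero ht', ← exp_add, ← ofReal_log (by positivity), ← ofReal_log hη.le,
    ← ofReal_log ht.le, Real.log_rpow h0, Real.log_mul hη.ne' (by positivity), Real.log_rpow ht]
  congr 1
  push_cast
  ring

/-- The prefactor `(2 / α) η^{δ/α} t^{β (δ/α + 1 - 1/β)}` of the moments. -/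
noncomputable def momentScale (α β η t : ℝ) (δ : ℂ) : ℂ :=
  2 / (α : ℂ) * (η : ℂ) ^ (δ / α) * (t : ℂ) ^ ((β : ℂ) * (δ / α + 1 - 1 / (β : ℂ)))

theorem momentScale_eq {α β η t : ℝ} (hβ : 0 < β) (hη : 0 < η) (ht : 0 < t) (δ : ℂ) :
    momentScale α β η t δ =
      2 * (((t ^ (β - 1) / α : ℝ) : ℂ) * (((η * t ^ β) ^ (1 / α) : ℝ) : ℂ) ^ δ) := by
  have ht' : (t : ℂ) ≠ 0 := ofReal_ne_zero.2 ht.ne'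
  have hβ' : (β : ℂ) ≠ 0 := ofReal_ne_zero.2 hβ.ne'
  rw [momentScale, ofReal_scale_cpow hη ht, ofReal_div, ofReal_cpow ht.le,
    show (β : ℂ) * (δ / α + 1 - 1 / β) = ((β - 1 : ℝ) : ℂ) + β * (δ / α) by
      push_cast; field_simp; ring, cpow_add _ _ ht']
  ring

open Set in
/-- The moments of the solution are the values of the holomorphic continuation of the
Mellin-Barnes kernel. -/
theorem integrable_and_moment_eq {α β η t γ a b : ℝ} {F : ℂ → ℂ} (hα : 0 < α) (hβ0 : 0 < β)
    (hβ2 : β < 2) (hη : 0 < η) (ht : 0 < t) (ha : -1 ≤ a)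
    (hd : DifferentiableOn ℂ F (re ⁻¹' Set.Ioo a b))
    (hF : ∀ s : ℂ, s.im ≠ 0 → F s = solutionKernel α β s) (hγ : γ ∈ Ioo a b) {δ : ℂ}
    (hδ : δ.re ∈ Ioo a b) :
    Integrable (momentIntegrand α β η γ t δ) ∧
      moment α β η γ t δ = momentScale α β η t δ * F δ := by
  have hdec := hasVerticalDecay_of_eq_solutionKernel hα hβ0 hβ2 ha hd hF
  set c := (η * t ^ β) ^ (1 / α) with hc
  have hc0 : 0 < c := by positivity
  set K : ℂ := ((t ^ (β - 1) / α : ℝ) : ℂ) with hK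
  set h : ℝ → ℂ := fun r => (r : ℂ) ^ δ * solution α β η γ r t
  have heq : momentIntegrand α β η γ t δ = fun x => h |x| := by
    ext x
    simp only [h, momentIntegrand, solution, abs_abs]
  -- The `1 / |x|` in the solution supplies the `-1` in the Mellin exponent `δ - 1`.
  have hpos : EqOn h (fun r : ℝ => K * ((r : ℂ) ^ (δ - 1) • mellinInv γ F (c⁻¹ * r))) (Ioi 0) := by
    intro r (hr : 0 < r)
    have hr' : (r : ℂ) ≠ 0 := ofReal_ne_zero.2 hr.ne'
    have hα' : (α : ℂ) ≠ 0 := ofReal_ne_zero.2 hα.ne'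
    simp only [h, solution, abs_of_pos hr]
    rw [foxH_eq_mellinInv hF, cpow_sub _ _ hr', cpow_one, hK, ← hc, smul_eq_mul,
      inv_mul_eq_div]
    push_cast
    field_simp
  have hconv : MellinConvergent (fun r => mellinInv γ F (c⁻¹ * r)) δ :=
    (MellinConvergent.comp_mul_left (inv_pos.2 hc0)).2
      (hdec.mellinConvergent_mellinInv hd hγ hδ)
  have hI : IntegrableOn h (Ioi 0) :=
    (integrableOn_congr_fun hpos measurableSet_Ioi).2 (hconv.const_mul K)
  refine ⟨heq ▸ hI.integrable_comp_abs, ?_⟩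
  have hval : ∫ r in Ioi (0 : ℝ), h r = K * ((c : ℂ) ^ δ * F δ) := by
    rw [setIntegral_congr_fun measurableSet_Ioi hpos, integral_const_mul]
    congr 1
    have := mellin_comp_mul_left (mellinInv γ F) δ (inv_pos.2 hc0)
    rw [hdec.mellin_mellinInv hd hγ hδ] at this
    rw [mellin] at this
    rw [this, smul_eq_mul, ofReal_inv, inv_cpow _ _ (by
      rw [arg_ofReal_of_nonneg hc0.le]; exact Real.pi_pos.ne), cpow_neg, inv_inv]
  rw [moment, heq, hI.integral_comp_abs, hval, momentScale_eq hβ0 hη ht, real_smul, ← hc, ← hK,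
    ofReal_ofNat]
  ring

end FractionalDiffusion

/-! ### Continuations of the kernel and the moment formula. -/

namespace FractionalDiffusion

open Complex

theorem differentiableAt_Gamma_of_re_pos {s : ℂ} (hs : 0 < s.re) :
    DifferentiableAt ℂ Gamma s := by
  refine differentiableAt_Gamma s fun m h => ?_
  rw [h] at hs
  simp at hs
  linarith [(Nat.cast_nonneg m : (0 : ℝ) ≤ m)]

/-- The holomorphic continuation of `solutionKernel` to the strip `-min 1 α < Re ξ < α`. -/
noncomputable def stripKernel (α β : ℝ) (ξ : ℂ) : ℂ :=
  α / 2 * (Gamma (1 + ξ) * Gamma (1 + ξ / α) * Gamma (1 - ξ / α)) *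
    ((Gamma (1 + ξ / 2))⁻¹ * (Gamma (1 - ξ / 2))⁻¹ * (Gamma (β + β * ξ / α))⁻¹)

/-- The functional equation at `-ξ/α` and `-ξ/2` cancels the pole at `0` against the zero there; the
quotient of the two linear factors leaves `α / 2`. -/
theorem stripKernel_eq {α : ℝ} (β : ℝ) (hα : 0 < α) {ξ : ℂ} (hξ : ξ ≠ 0) :
    stripKernel α β ξ = solutionKernel α β ξ := by
  have hα' : (α : ℂ) ≠ 0 := ofReal_ne_zero.2 hα.ne'
  have h1 := Gamma_add_one (-(ξ / α)) (neg_ne_zero.2 (div_ne_zero hξ hα'))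
  have h2 := Gamma_add_one (-(ξ / 2)) (neg_ne_zero.2 (div_ne_zero hξ two_ne_zero))
  rw [neg_add_eq_sub] at h1 h2
  rw [stripKernel, solutionKernel_eq, h1, h2, mul_inv, inv_neg, inv_div,
    div_eq_mul_inv (Gamma (-(ξ / α)) * _ * _), mul_inv, mul_inv]
  field_simp

theorem re_one_add_div_pos {α : ℝ} {ξ : ℂ} (hα : 0 < α) (h : 0 < ξ.re + α) :
    0 < (1 + ξ / α).re := by
  rw [add_re, one_re, div_ofReal_re, ← div_self hα.ne', ← add_div]
  exact div_pos (by linarith) hα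

theorem re_one_sub_div_pos {α : ℝ} {ξ : ℂ} (hα : 0 < α) (h : ξ.re < α) :
    0 < (1 - ξ / α).re := by
  rw [sub_re, one_re, div_ofReal_re, ← div_self hα.ne', ← sub_div]
  exact div_pos (by linarith) hα

theorem differentiableAt_stripKernel {α β : ℝ} {ξ : ℂ} (hα : 0 < α) (h1 : -1 < ξ.re)
    (h2 : 0 < ξ.re + α) (h3 : ξ.re < α) : DifferentiableAt ℂ (stripKernel α β) ξ := by
  have d1 : DifferentiableAt ℂ (fun ξ => Gamma (1 + ξ)) ξ :=
    (differentiableAt_Gamma_of_re_pos (by simp; linarith)).comp ξ (by fun_prop)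
  have d2 : DifferentiableAt ℂ (fun ξ => Gamma (1 + ξ / α)) ξ :=
    (differentiableAt_Gamma_of_re_pos (re_one_add_div_pos hα h2)).comp ξ (by fun_prop)
  have d3 : DifferentiableAt ℂ (fun ξ => Gamma (1 - ξ / α)) ξ :=
    (differentiableAt_Gamma_of_re_pos (re_one_sub_div_pos hα h3)).comp ξ (by fun_prop)
  have d4 : DifferentiableAt ℂ (fun ξ => (Gamma (1 + ξ / 2))⁻¹) ξ :=
    (differentiable_one_div_Gamma _).comp ξ (by fun_prop)
  have d5 : DifferentiableAt ℂ (fun ξ => (Gamma (1 - ξ / 2))⁻¹) ξ :=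
    (differentiable_one_div_Gamma _).comp ξ (by fun_prop)
  have d6 : DifferentiableAt ℂ (fun ξ => (Gamma (β + β * ξ / α))⁻¹) ξ :=
    (differentiable_one_div_Gamma _).comp ξ (by fun_prop)
  unfold stripKernel
  exact ((d1.mul d2 |>.mul d3).const_mul _).mul ((d4.mul d5).mul d6)

theorem continuousAt_stripKernel_left {α β : ℝ} {ξ : ℂ} (hα : 0 < α)
    (h2 : 0 < ξ.re + α) (h3 : ξ.re < α) : ContinuousAt (fun a => stripKernel a β ξ) α := by
  have hα' : (α : ℂ) ≠ 0 := ofReal_ne_zero.2 hα.ne'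
  have c0 : ContinuousAt (fun a : ℝ => (a : ℂ)) α := continuous_ofReal.continuousAt
  have c1 : ContinuousAt (fun a : ℝ => ξ / (a : ℂ)) α := continuousAt_const.div c0 hα'
  have c2 : ContinuousAt (fun a : ℝ => Gamma (1 + ξ / a)) α :=
    ContinuousAt.comp (f := fun a : ℝ => 1 + ξ / (a : ℂ))
      (differentiableAt_Gamma_of_re_pos (re_one_add_div_pos hα h2)).continuousAt
      (continuousAt_const.add c1)
  have c3 : ContinuousAt (fun a : ℝ => Gamma (1 - ξ / a)) α :=
    ContinuousAt.comp (f := fun a : ℝ => 1 - ξ / (a : ℂ))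
      (differentiableAt_Gamma_of_re_pos (re_one_sub_div_pos hα h3)).continuousAt
      (continuousAt_const.sub c1)
  have c4 : ContinuousAt (fun a : ℝ => (Gamma (β + β * ξ / a))⁻¹) α :=
    ContinuousAt.comp (g := fun s => (Gamma s)⁻¹) (f := fun a : ℝ => β + β * ξ / (a : ℂ))
      (differentiable_one_div_Gamma _).continuousAt
      (continuousAt_const.add (continuousAt_const.div c0 hα'))
  unfold stripKernel
  exact ((c0.div_const 2).mul ((continuousAt_const.mul c2).mul c3)).mul (continuousAt_const.mul c4)

theorem continuous_momentScale {α β η t : ℝ} (hη : 0 < η) (ht : 0 < t) :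
    Continuous (momentScale α β η t) := by
  have h1 : Continuous fun δ : ℂ => (η : ℂ) ^ (δ / α) :=
    (continuous_id.div_const _).const_cpow (Or.inl (ofReal_ne_zero.2 hη.ne'))
  have h2 : Continuous fun δ : ℂ => (t : ℂ) ^ ((β : ℂ) * (δ / α + 1 - 1 / (β : ℂ))) :=
    Continuous.const_cpow (by fun_prop) (Or.inl (ofReal_ne_zero.2 ht.ne'))
  exact (continuous_const.mul h1).mul h2

theorem continuousAt_momentScale_left {α β η t : ℝ} (hα : 0 < α) (hη : 0 < η) (ht : 0 < t)
    (δ : ℂ) : ContinuousAt (fun a => momentScale a β η t δ) α := by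
  have hα' : (α : ℂ) ≠ 0 := ofReal_ne_zero.2 hα.ne'
  have c0 : ContinuousAt (fun a : ℝ => (a : ℂ)) α := continuous_ofReal.continuousAt
  have c1 : ContinuousAt (fun a : ℝ => δ / (a : ℂ)) α := continuousAt_const.div c0 hα'
  have c2 : ContinuousAt (fun a : ℝ => (η : ℂ) ^ (δ / a)) α :=
    c1.const_cpow (Or.inl (ofReal_ne_zero.2 hη.ne'))
  have c3 : ContinuousAt (fun a : ℝ => (t : ℂ) ^ ((β : ℂ) * (δ / a + 1 - 1 / (β : ℂ)))) α :=
    (continuousAt_const.mul ((c1.add continuousAt_const).sub continuousAt_const)).const_cpow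
      (Or.inl (ofReal_ne_zero.2 ht.ne'))
  exact ((continuousAt_const.div c0 hα').mul c2).mul c3

theorem moment_eq_stripKernel {α β η t γ : ℝ} (hα : 0 < α) (hβ0 : 0 < β) (hβ2 : β < 2)
    (hη : 0 < η) (ht : 0 < t) (hγ : AdmissibleLine α β γ) {δ : ℂ} (h1 : -1 < δ.re)
    (h2 : 0 < δ.re + α) (h3 : δ.re < α) :
    Integrable (momentIntegrand α β η γ t δ) ∧
      moment α β η γ t δ = momentScale α β η t δ * stripKernel α β δ := by
  have hm : ∀ x : ℝ, -min 1 α < x ↔ -1 < x ∧ 0 < x + α := fun x => by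
    rw [neg_lt, lt_min_iff]
    constructor <;> rintro ⟨_, _⟩ <;> constructor <;> linarith
  refine integrable_and_moment_eq (a := -min 1 α) (b := α) hα hβ0 hβ2 hη ht
    (neg_le_neg (min_le_left _ _)) (fun s hs => ?_) (fun s hs => ?_)
    ⟨hγ.mem_Ioo.1, hγ.mem_Ioo.2.trans hα⟩ ⟨(hm _).2 ⟨h1, h2⟩, h3⟩
  · have := (hm _).1 hs.1
    exact (differentiableAt_stripKernel hα this.1 this.2 hs.2).differentiableWithinAt
  · exact stripKernel_eq β hα fun h => hs (by rw [h]; simp)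

/-- For `α = 2 (n + 1)` the holomorphic continuation of `solutionKernel` to the half-plane
`-1 < Re ξ`. -/
noncomputable def halfPlaneKernel (n : ℕ) (α β : ℝ) (ξ : ℂ) : ℂ :=
  Gamma (1 + ξ) * (Polynomial.Chebyshev.U ℂ n).eval (cos (Real.pi * (ξ / α))) *
    (Gamma (β + β * ξ / α))⁻¹

/-- With `θ = πξ/α` one has `πξ/2 = (n + 1)θ`, and `sin ((n + 1)θ) = U_n(cos θ) sin θ`. -/
theorem halfPlaneKernel_eq {n : ℕ} {α : ℝ} (β : ℝ) (hα : α = 2 * (n + 1)) {ξ : ℂ}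
    (hξ : sin (Real.pi * (ξ / α)) ≠ 0) : halfPlaneKernel n α β ξ = solutionKernel α β ξ := by
  have hn : (n : ℂ) + 1 ≠ 0 := Nat.cast_add_one_ne_zero n
  have h := Polynomial.Chebyshev.U_complex_cos (Real.pi * (ξ / α)) n
  have h2 : (((n : ℤ) : ℂ) + 1) * (Real.pi * (ξ / α)) = Real.pi * (ξ / 2) := by
    rw [hα]
    push_cast
    field_simp
  rw [h2] at h
  rw [halfPlaneKernel, solutionKernel_eq_sin, ← h, ← mul_assoc, mul_inv_cancel_right₀ hξ]

theorem differentiableAt_halfPlaneKernel (n : ℕ) (α β : ℝ) {ξ : ℂ} (h1 : -1 < ξ.re) :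
    DifferentiableAt ℂ (halfPlaneKernel n α β) ξ := by
  have d1 : DifferentiableAt ℂ (fun ξ => Gamma (1 + ξ)) ξ :=
    (differentiableAt_Gamma_of_re_pos (by simp; linarith)).comp ξ (by fun_prop)
  have d2 : DifferentiableAt ℂ
      (fun ξ => (Polynomial.Chebyshev.U ℂ n).eval (cos (Real.pi * (ξ / α)))) ξ :=
    DifferentiableAt.comp (f := fun ξ : ℂ => cos (Real.pi * (ξ / α))) ξ
      (Polynomial.differentiable _ _) (by fun_prop)
  have d3 : DifferentiableAt ℂ (fun ξ => (Gamma (β + β * ξ / α))⁻¹) ξ :=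
    (differentiable_one_div_Gamma _).comp ξ (by fun_prop)
  exact (d1.mul d2).mul d3

theorem sin_pi_mul_div_ne_zero {α : ℝ} (hα : 0 < α) {ξ : ℂ} (hξ : 0 < ξ.re + α)
    (h : ∀ k : ℕ, ξ ≠ (k : ℂ) * α) : sin (Real.pi * (ξ / α)) ≠ 0 := by
  have hα' : (α : ℂ) ≠ 0 := ofReal_ne_zero.2 hα.ne'
  have hpi : (Real.pi : ℂ) ≠ 0 := ofReal_ne_zero.2 Real.pi_ne_zero
  rw [Ne, sin_eq_zero_iff]
  rintro ⟨k, hk⟩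
  have hk' : ξ = k * α := by
    field_simp at hk
    rw [hk, mul_comm]
  have hre : ξ.re = k * α := by rw [hk']; simp
  rw [hre, ← add_one_mul] at hξ
  have h0 : (0 : ℝ) < k + 1 := pos_of_mul_pos_left hξ hα.le
  have h1 : 0 ≤ k := by
    have : (0 : ℤ) < k + 1 := by exact_mod_cast h0
    omega
  obtain ⟨m, rfl⟩ := Int.eq_ofNat_of_zero_le h1
  exact h m (by simpa using hk')

theorem moment_eq_halfPlaneKernel {n : ℕ} {α β η t γ : ℝ} (hα : α = 2 * (n + 1)) (hβ0 : 0 < β)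
    (hβ2 : β < 2) (hη : 0 < η) (ht : 0 < t) (hγ : AdmissibleLine α β γ) {δ : ℂ}
    (h1 : -1 < δ.re) :
    Integrable (momentIntegrand α β η γ t δ) ∧
      moment α β η γ t δ = momentScale α β η t δ * halfPlaneKernel n α β δ := by
  have hα0 : 0 < α := by rw [hα]; positivity
  have hα1 : 1 ≤ α := by rw [hα]; linarith [(Nat.cast_nonneg n : (0 : ℝ) ≤ n)]
  have hγ' := hγ.mem_Ioo
  rw [min_eq_left hα1] at hγ'
  refine integrable_and_moment_eq (a := -1) (b := |δ.re| + 1) hα0 hβ0 hβ2 hη ht le_rfl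
    (fun s hs => ?_) (fun s hs => ?_) ⟨hγ'.1, hγ'.2.trans (by positivity)⟩
    ⟨h1, (le_abs_self _).trans_lt (lt_add_one _)⟩
  · exact (differentiableAt_halfPlaneKernel n α β hs.1).differentiableWithinAt
  · refine halfPlaneKernel_eq β hα ?_
    rw [Ne, sin_eq_zero_iff]
    rintro ⟨k, hk⟩
    have := congrArg im hk
    rw [im_ofReal_mul, div_ofReal_im] at this
    simp [hs, hα0.ne', Real.pi_ne_zero] at this

theorem moment_formula {α β η t γ : ℝ} (hα : 0 < α) (hβ0 : 0 < β) (hβ2 : β < 2)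
    (hη : 0 < η) (ht : 0 < t) (hγ : AdmissibleLine α β γ) {δ : ℂ} (h1 : -1 < δ.re)
    (h2 : 0 < δ.re + α) (h3 : δ.re < α ∨ ∃ m : ℕ, α = 2 * m) (h4 : ∀ k : ℕ, δ ≠ (k : ℂ) * α) :
    Integrable (momentIntegrand α β η γ t δ) ∧
      moment α β η γ t δ = momentScale α β η t δ * solutionKernel α β δ := by
  rcases h3 with h3 | ⟨m, hm⟩
  · rw [← stripKernel_eq β hα (by simpa using h4 0)]
    exact moment_eq_stripKernel hα hβ0 hβ2 hη ht hγ h1 h2 h3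
  · obtain ⟨n, rfl⟩ : ∃ n, m = n + 1 := by
      refine Nat.exists_eq_succ_of_ne_zero fun h => hα.ne' ?_
      rw [hm, h]; simp
    have hm' : α = 2 * (n + 1) := by rw [hm]; push_cast; ring
    rw [← halfPlaneKernel_eq β hm' (sin_pi_mul_div_ne_zero hα h2 h4)]
    exact moment_eq_halfPlaneKernel hm' hβ0 hβ2 hη ht hγ h1

/-! ### Limits of the moments and the mean squared displacement. -/

theorem tendsto_moment_zero {α β η t γ : ℝ} (hα : 0 < α) (hβ0 : 0 < β) (hβ2 : β < 2)
    (hη : 0 < η) (ht : 0 < t) (hγ : AdmissibleLine α β γ) :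
    Tendsto (fun δ : ℂ => moment α β η γ t δ) (𝓝[≠] 0)
      (𝓝 ((t ^ (β - 1) / Real.Gamma β : ℝ) : ℂ)) := by
  have hα' : (α : ℂ) ≠ 0 := ofReal_ne_zero.2 hα.ne'
  have hval : momentScale α β η t 0 * stripKernel α β 0 =
      ((t ^ (β - 1) / Real.Gamma β : ℝ) : ℂ) := by
    rw [momentScale_eq hβ0 hη ht, stripKernel]
    push_cast [← Complex.Gamma_ofReal]
    simp
    field_simp
  rw [← hval]
  have hcont : ContinuousAt (fun δ => momentScale α β η t δ * stripKernel α β δ) 0 :=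
    (continuous_momentScale hη ht).continuousAt.mul
      (differentiableAt_stripKernel hα (by simp) (by simpa using hα)
        (by simpa using hα)).continuousAt
  refine (hcont.tendsto.mono_left nhdsWithin_le_nhds).congr' ?_
  refine (Filter.Eventually.filter_mono nhdsWithin_le_nhds ?_)
  have hre : Tendsto re (𝓝 (0 : ℂ)) (𝓝 0) := by simpa using continuous_re.tendsto 0
  filter_upwards [hre.eventually (lt_mem_nhds (neg_lt_zero.2 zero_lt_one)),
    hre.eventually (lt_mem_nhds (neg_lt_zero.2 hα)), hre.eventually (gt_mem_nhds hα)]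
    with δ e1 e2 e3
  exact (moment_eq_stripKernel hα hβ0 hβ2 hη ht hγ e1 (by linarith) e3).2.symm

/-- For `α ≥ 1` admissibility means `-1 < γ < 0`, so one contour can be kept fixed while `α → 2`. -/
theorem admissibleLine_of_two {α β γ : ℝ} (hα : 1 ≤ α) (h : AdmissibleLine 2 β γ) :
    AdmissibleLine α β γ := by
  obtain ⟨h1, h2⟩ := h.mem_Ioo
  rw [min_eq_left one_le_two] at h1
  have hα0 : 0 < α := by linarith
  constructor
  · intro j hj k
    have hk : (0 : ℝ) ≤ k := Nat.cast_nonneg k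
    have hj' : j = 0 ∨ j = 1 := by omega
    rcases hj' with rfl | rfl
    · simp [lower, lowerScale]; linarith
    · simp [lower, lowerScale]; nlinarith
  · intro i hi k
    have hi' : i = 0 := by omega
    subst hi'
    simp [upper, upperScale]
    exact h2.trans_le (by positivity)

theorem moment_two_eq {β η t γ : ℝ} (hβ0 : 0 < β) (hβ2 : β < 2) (hη : 0 < η) (ht : 0 < t)
    (hγ : AdmissibleLine 2 β γ) {δ : ℂ} (h1 : -1 < δ.re) :
    Integrable (momentIntegrand 2 β η γ t δ) ∧
      moment 2 β η γ t δ = momentScale 2 β η t δ * halfPlaneKernel 0 2 β δ :=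
  moment_eq_halfPlaneKernel (by norm_num) hβ0 hβ2 hη ht hγ h1

theorem momentScale_mul_halfPlaneKernel_two {β η t : ℝ} (hβ0 : 0 < β) (ht : 0 < t) :
    momentScale 2 β η t 2 * halfPlaneKernel 0 2 β 2 =
      ((2 * η * t ^ (2 * β - 1) / Real.Gamma (2 * β) : ℝ) : ℂ) := by
  have hβ' : (β : ℂ) ≠ 0 := ofReal_ne_zero.2 hβ0.ne'
  have e1 : (β : ℂ) * ((2 : ℂ) / ((2 : ℝ) : ℂ) + 1 - 1 / (β : ℂ)) = ((2 * β - 1 : ℝ) : ℂ) := by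
    push_cast; field_simp; ring
  have e2 : (β : ℂ) + β * 2 / ((2 : ℝ) : ℂ) = ((2 * β : ℝ) : ℂ) := by
    push_cast; ring
  have e3 : Gamma (1 + 2) = 2 := by
    have := Gamma_nat_eq_factorial 2
    norm_num at this ⊢
  rw [momentScale, halfPlaneKernel, e1, e2, e3, Complex.Gamma_ofReal, ← ofReal_cpow ht.le]
  push_cast
  simp
  ring

theorem tendsto_moment_two {β η t γ : ℝ} (hβ0 : 0 < β) (hβ2 : β < 2) (hη : 0 < η) (ht : 0 < t)
    (hγ : AdmissibleLine 2 β γ) :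
    Tendsto (fun δ : ℂ => moment 2 β η γ t δ) (𝓝[≠] 2)
      (𝓝 ((2 * η * t ^ (2 * β - 1) / Real.Gamma (2 * β) : ℝ) : ℂ)) := by
  rw [← momentScale_mul_halfPlaneKernel_two hβ0 ht]
  have hcont : ContinuousAt (fun δ => momentScale 2 β η t δ * halfPlaneKernel 0 2 β δ) 2 :=
    (continuous_momentScale hη ht).continuousAt.mul
      (differentiableAt_halfPlaneKernel 0 2 β (by simp; norm_num)).continuousAt
  refine (hcont.tendsto.mono_left nhdsWithin_le_nhds).congr' ?_
  refine (Filter.Eventually.filter_mono nhdsWithin_le_nhds ?_)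
  have hre : Tendsto re (𝓝 (2 : ℂ)) (𝓝 2) := by simpa using continuous_re.tendsto 2
  filter_upwards [hre.eventually (lt_mem_nhds (show (-1 : ℝ) < 2 by norm_num))] with δ e1
  exact (moment_two_eq hβ0 hβ2 hη ht hγ e1).2.symm

/-- Near `2` the inequality `Re δ < α` persists, so `stripKernel` describes the moment on both sides
of `α = 2` and its continuity in `α` suffices. -/
theorem tendsto_moment_of_tendsto_two {β η t γ : ℝ} (hβ0 : 0 < β) (hβ2 : β < 2) (hη : 0 < η)
    (ht : 0 < t) (hγ : AdmissibleLine 2 β γ) {δ : ℂ} (h1 : -1 < δ.re) (h2 : δ.re < 2) :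
    Tendsto (fun α : ℝ => moment α β η γ t δ) (𝓝[≠] 2) (𝓝 (moment 2 β η γ t δ)) := by
  rw [(moment_eq_stripKernel two_pos hβ0 hβ2 hη ht hγ h1 (by linarith) h2).2]
  have hcont : ContinuousAt (fun α => momentScale α β η t δ * stripKernel α β δ) 2 :=
    (continuousAt_momentScale_left two_pos hη ht δ).mul
      (continuousAt_stripKernel_left two_pos (by linarith) h2)
  refine (hcont.tendsto.mono_left nhdsWithin_le_nhds).congr' ?_
  refine (Filter.Eventually.filter_mono nhdsWithin_le_nhds ?_)
  filter_upwards [lt_mem_nhds (show (1 : ℝ) < 2 by norm_num), lt_mem_nhds h2] with α e1 e2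
  exact (moment_eq_stripKernel (by linarith) hβ0 hβ2 hη ht (admissibleLine_of_two e1.le hγ) h1
    (by linarith) e2).2.symm

end FractionalDiffusion

theorem mainTheorem4 (β η t : ℝ) (hβ0 : 0 < β) (hβ2 : β < 2) (hη : 0 < η) (ht : 0 < t) :
    -- the explicit formula for the fractional moments
    (∀ α γ : ℝ, 0 < α → FractionalDiffusion.AdmissibleLine α β γ →
      ∀ δ : ℂ, -1 < δ.re → 0 < δ.re + α → (δ.re < α ∨ ∃ m : ℕ, α = 2 * m) →
        (∀ k : ℕ, δ ≠ (k : ℂ) * α) →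
        Integrable (FractionalDiffusion.momentIntegrand α β η γ t δ) ∧
        FractionalDiffusion.moment α β η γ t δ =
          2 / (α : ℂ) * (η : ℂ) ^ (δ / α) * (t : ℂ) ^ ((β : ℂ) * (δ / α + 1 - 1 / (β : ℂ))) *
            (Complex.Gamma (-(δ / α)) * Complex.Gamma (1 + δ) * Complex.Gamma (1 + δ / α) /
              (Complex.Gamma (-(δ / 2)) * Complex.Gamma (β + β * δ / α) *
                Complex.Gamma (1 + δ / 2)))) ∧
    -- the limit `δ → 0`
    (∀ α γ : ℝ, 0 < α → FractionalDiffusion.AdmissibleLine α β γ →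
      Tendsto (fun δ : ℂ => FractionalDiffusion.moment α β η γ t δ) (𝓝[≠] 0)
        (𝓝 ((t ^ (β - 1) / Real.Gamma β : ℝ) : ℂ))) ∧
    -- the mean squared displacement: `α = 2`, `δ = 2`
    (∀ γ : ℝ, FractionalDiffusion.AdmissibleLine 2 β γ →
      Integrable (FractionalDiffusion.momentIntegrand 2 β η γ t 2) ∧
      FractionalDiffusion.moment 2 β η γ t 2 =
        ((2 * η * t ^ (2 * β - 1) / Real.Gamma (2 * β) : ℝ) : ℂ) ∧
      -- and as the limit `α → 2` followed by `δ → 2`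
      (∀ δ : ℂ, -1 < δ.re → δ.re < 2 →
        Tendsto (fun α : ℝ => FractionalDiffusion.moment α β η γ t δ) (𝓝[≠] 2)
          (𝓝 (FractionalDiffusion.moment 2 β η γ t δ))) ∧
      Tendsto (fun δ : ℂ => FractionalDiffusion.moment 2 β η γ t δ) (𝓝[≠] 2)
        (𝓝 ((2 * η * t ^ (2 * β - 1) / Real.Gamma (2 * β) : ℝ) : ℂ))) := by
  refine ⟨fun α γ hα hγ δ h1 h2 h3 h4 => ?_, fun α γ hα hγ =>
    FractionalDiffusion.tendsto_moment_zero hα hβ0 hβ2 hη ht hγ, fun γ hγ => ⟨?_, ?_, ?_, ?_⟩⟩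
  · have := FractionalDiffusion.moment_formula hα hβ0 hβ2 hη ht hγ h1 h2 h3 h4
    rw [FractionalDiffusion.solutionKernel_eq, FractionalDiffusion.momentScale] at this
    exact this
  · exact (FractionalDiffusion.moment_two_eq hβ0 hβ2 hη ht hγ (by simp; norm_num)).1
  · rw [(FractionalDiffusion.moment_two_eq hβ0 hβ2 hη ht hγ (by simp; norm_num)).2]
    exact FractionalDiffusion.momentScale_mul_halfPlaneKernel_two hβ0 ht
  · exact fun δ h1 h2 =>
      FractionalDiffusion.tendsto_moment_of_tendsto_two hβ0 hβ2 hη ht hγ h1 h2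
  · exact FractionalDiffusion.tendsto_moment_two hβ0 hβ2 hη ht hγ
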